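/- **Setting.** There are $n\ge 1$ bidders and one item. Bidder $i$ has a private value in $T_i\subseteq[0,H]$ ($H>0$) and bids $b_i\in[0,H]$. The highest bidder wins and ties are broken uniformly at random: given bids $b=(b_1,\dots,b_n)$, bidder $i$ receives the item with probability $x_i(b)=\mathbb I[b_i=\max_j b_j]/|\operatorname{argmax}_j b_j|$. She pays $p_i(b)=x_i(b)f_i(b_i)+g_i(b_i)$, where $f_i,g_i:[0,H]\to[0,H]$ are measurable (the first-price auction is $f_i(b)=b$, $g_i=0$; the all-pay auction is $f_i=0$, $g_i(b)=b$). Her ex post utility is $U_i(v_i,b)=v_ix_i(b)-p_i(b)$. A strategy of bidder $i$ is a map $s_i:T_i\to[0,H]$; $S_i$ is the set of these and $S=\prod_i S_i$. For a product distribution $D=\prod_i D_i$ on $\prod_i T_i$, the interim utility is $u_i(v_i,b_i,s_{-i})=\mathbb E_{v_{-i}\sim D_{-i}}[U_i(v_i,(b_i,s_{-i}(v_{-i})))]$. A distribution $Q\in\Delta(S)$ is a probability measure on $S$, on some $\sigma$-algebra for which all recommended bids $s_i(v_i)$ are random variables. For $\varepsilon\ge 0$, $Q$ is an $\varepsilon$-Bayes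 correlated equilibrium ($\varepsilon$-BCE) on $D$ if for every bidder $i$, every value $v_i\in T_i$ and every deviation function $\phi_i:S_i\times T_i\to[0,H]$ (measurable, in that $s\mapsto\phi_i(s_i,v_i)$ is a random variable for each $v_i$), the following expectations exist and $$\mathbb E_{s\sim Q}[u_i(v_i,s_i(v_i),s_{-i})]\ \ge\ \mathbb E_{s\sim Q}[u_i(v_i,\phi_i(s_i,v_i),s_{-i})]-\varepsilon .$$ $Q$ is monotone if almost surely every $s_i$ is weakly increasing. Let $\mathrm{BCE}(D,\varepsilon)$ be the set of monotone $\varepsilon$-BCEs on $D$. Given samples $v^{(1)},\dots,v^{(m)}$ from $D$, let $\hat D_i$ be the uniform distribution on the $m$ sampled values $v_i^{(1)},\dots,v_i^{(m)}$ of bidder $i$ (counted with multiplicity), regarded as a distribution on $T_i$, and let $\hat D=\prod_i\hat D_i$ be the empirical product distribution. **Theorem.** There is an absolute constant $C>0$ such that the following holds for all $n$, $H$, $(f_i)$, $(g_i)$, $(T_i)$ as above, every product distribution $D=\prod_i D_i$ on $\prod_i T_i$, all $\varepsilon,\varepsilon'>0$, all $\delta\in(0,1)$, and every integer $m\ge1$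 with $$m\ \ge\ C\,\frac{H^2}{\varepsilon^2}\left[n\log n\,\log\frac{H}{\varepsilon}+\log\frac n\delta\right].$$ With probability at least $1-\delta$ over $m$ i.i.d. samples from $D$, $$\mathrm{BCE}(\hat D,\varepsilon')\subseteq\mathrm{BCE}(D,\varepsilon'+2\varepsilon)\qquad\text{and}\qquad \mathrm{BCE}(D,\varepsilon')\subseteq\mathrm{BCE}(\hat D,\varepsilon'+2\varepsilon).$$ -/

import Mathlib

open MeasureTheory Set
open scoped ENNReal

namespace Auction

/-- The set `[0, H]` of bids. -/
abbrev Bid (H : ℝ) : Type := Set.Icc (0 : ℝ) H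

/-- Joint bidding strategies: bidder `i` maps every value in the value space `T i` to a bid in
`[0, H]`. It carries no `σ`-algebra by itself, see `StrategyDist`. -/
def JointStrategy {n : ℕ} (T : Fin n → Set ℝ) (H : ℝ) : Type :=
  ∀ i : Fin n, T i → Bid H

/-- The probability `x_i(b)` that bidder `i` receives the item: the highest bid wins and ties are
broken uniformly at random. -/
noncomputable def alloc {n : ℕ} {H : ℝ} (i : Fin n) (b : Fin n → Bid H) : ℝ :=
  open Classical in
  if ∀ j, b j ≤ b i then
    1 / ((Finset.univ.filter fun j : Fin n => ∀ k, b k ≤ b j).card : ℝ)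
  else 0

/-- The payment `p_i(b) = x_i(b) f_i(b_i) + g_i(b_i)`. -/
noncomputable def payment {n : ℕ} {H : ℝ} (f g : Fin n → Bid H → Bid H) (i : Fin n)
    (b : Fin n → Bid H) : ℝ :=
  alloc i b * (f i (b i) : ℝ) + (g i (b i) : ℝ)

/-- The ex post utility `U_i(v_i, b) = v_i x_i(b) - p_i(b)`. -/
noncomputable def exPostUtility {n : ℕ} {H : ℝ} (f g : Fin n → Bid H → Bid H) (i : Fin n)
    (v : ℝ) (b : Fin n → Bid H) : ℝ :=
  v * alloc i b - payment f g i b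

/-- The interim utility `u_i(v_i, b_i, s_{-i})` of bidder `i` with value `v` and bid `b` when the
values of the other bidders are drawn from the product distribution `∏ D j` and the others play
`s`. The integrand does not depend on the coordinate `t i`, so averaging over the whole profile
`t` amounts to averaging over `t_{-i}`. -/
noncomputable def interimUtility {n : ℕ} {H : ℝ} {T : Fin n → Set ℝ}
    (f g : Fin n → Bid H → Bid H) (D : ∀ i, Measure (T i)) (i : Fin n) (v : T i) (b : Bid H)
    (s : JointStrategy T H) : ℝ :=
  ∫ t : (∀ j, T j), exPostUtility f g i (v : ℝ) (Function.update (fun j => s j (t j)) i b)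
    ∂(Measure.pi D)

/-- Distributions over joint bidding strategies: probability measures on the set of joint
strategies, with respect to any `σ`-algebra for which every recommended bid `s i v` is a random
variable. (The product `σ`-algebra alone would not contain the set of monotone strategies when
the value spaces are uncountable, so it is not imposed as the only choice.) -/
structure StrategyDist {n : ℕ} (T : Fin n → Set ℝ) (H : ℝ) where
  /-- The events. -/
  events : MeasurableSpace (JointStrategy T H)
  /-- Every recommended bid is a random variable. -/
  measurable_bid : ∀ (i : Fin n) (v : T i),
    Measurable[events] (fun s : JointStrategy T H => s i v)
  /-- The probability measure. -/
  law : @Measure (JointStrategy T H) events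
  /-- It has total mass one. -/
  isProbability : IsProbabilityMeasure law

/-- `Q` is monotone: a joint strategy sampled from `Q` is (almost surely) weakly increasing in
each bidder's value. -/
def StrategyDist.IsMonotone {n : ℕ} {T : Fin n → Set ℝ} {H : ℝ} (Q : StrategyDist T H) : Prop :=
  ∀ᵐ s ∂Q.law, ∀ i : Fin n, Monotone (s i)

/-- A deviation function `φ_i` of bidder `i` (from recommended strategies and values to bids) for
which the deviating bid of each value is a random variable under `Q`. -/
def StrategyDist.IsDeviation {n : ℕ} {T : Fin n → Set ℝ} {H : ℝ} (Q : StrategyDist T H)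
    (i : Fin n) (φ : (T i → Bid H) → T i → Bid H) : Prop :=
  ∀ v : T i, Measurable[Q.events] (fun s : JointStrategy T H => φ (s i) v)

/-- `Q` is an `ε`-Bayes correlated equilibrium for the product value distribution `∏ D i`: the
expected utilities below exist, and no bidder, whatever her value in `T i`, gains more than `ε` in
expectation by any deviation function. -/
structure IsBCE {n : ℕ} {H : ℝ} {T : Fin n → Set ℝ} (f g : Fin n → Bid H → Bid H)
    (D : ∀ i, Measure (T i)) (ε : ℝ) (Q : StrategyDist T H) : Prop where
  integrable_recommended : ∀ (i : Fin n) (v : T i),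
    Integrable (fun s => interimUtility f g D i v (s i v) s) Q.law
  integrable_deviation : ∀ (i : Fin n) (v : T i) (φ : (T i → Bid H) → T i → Bid H),
    Q.IsDeviation i φ →
      Integrable (fun s => interimUtility f g D i v (φ (s i) v) s) Q.law
  incentive : ∀ (i : Fin n) (v : T i) (φ : (T i → Bid H) → T i → Bid H),
    Q.IsDeviation i φ →
      (∫ s, interimUtility f g D i v (φ (s i) v) s ∂Q.law) - ε
        ≤ ∫ s, interimUtility f g D i v (s i v) s ∂Q.law

/-- `BCE(D, ε)`: the set of monotone `ε`-Bayes correlated equilibria. -/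
def BCE {n : ℕ} {H : ℝ} {T : Fin n → Set ℝ} (f g : Fin n → Bid H → Bid H)
    (D : ∀ i, Measure (T i)) (ε : ℝ) : Set (StrategyDist T H) :=
  {Q | Q.IsMonotone ∧ IsBCE f g D ε Q}

/-- The `i`-th marginal of the empirical product distribution of the samples `x 0, …, x (m - 1)`:
the uniform distribution over the (multiset of) sampled values of bidder `i`. -/
noncomputable def empirical {n m : ℕ} {T : Fin n → Set ℝ} (x : Fin m → ∀ i, T i) (i : Fin n) :
    Measure (T i) :=
  (m : ℝ≥0∞)⁻¹ • ∑ k : Fin m, Measure.dirac (x k i)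

end Auction

open ProbabilityTheory
open scoped NNReal

namespace Auction

/-! Incentive constraints see the value distribution only through gains from deviating. By
`interimUtility_eq`, a gain is an explicit function of two winning probabilities. It is therefore
enough that winning probabilities under the empirical product and under `D` differ by at most `ε /
H`, uniformly over monotone strategies and bids. Gains then move by at most `2 * ε`, and this
survives integration over `Q` (`BCE_subset_of_gain_close`).

For monotone strategies, the values at which a rival bids at most `b`, or less than `b`, form lower
sets of a line. The winning probability is monotone in these sets (`tieShare_mono`). Lower sets are
covered by `K + 1` brackets of mass at most `1 / K` (`exists_bracket`), so a union bound over
finitely many functions controls all strategies at once (`exists_event_uniform_tieShare`).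

For one fixed function, the empirical product mean runs over all `m ^ n` recombinations of the
samples, which are dependent. It is, however, an average over coordinatewise shifts of ordinary
means of `m` i.i.d. profiles. Convexity of `exp` passes the sub-Gaussian bound to the average, so
Hoeffding's inequality holds with no loss (`hasSubgaussianMGF_empirical`).

An equilibrium also requires its expectations to exist under the new distribution;
`integrable_interimUtility` provides this from monotonicity. -/

/-- An average of (possibly dependent) sub-Gaussian variables is sub-Gaussian. -/
theorem hasSubgaussianMGF_average {Ω ι : Type*} [MeasurableSpace Ω] {μ : Measure Ω}
    [Fintype ι] [Nonempty ι] {X : ι → Ω → ℝ} {c : ℝ≥0}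
    (hX : ∀ i, HasSubgaussianMGF (X i) c μ) :
    HasSubgaussianMGF (fun ω => (Fintype.card ι : ℝ)⁻¹ * ∑ i, X i ω) c μ := by
  have hcard : (0 : ℝ) < Fintype.card ι := by exact_mod_cast Fintype.card_pos
  have hjensen : ∀ (t : ℝ) (ω : Ω), Real.exp (t * ((Fintype.card ι : ℝ)⁻¹ * ∑ i, X i ω))
      ≤ (Fintype.card ι : ℝ)⁻¹ * ∑ i, Real.exp (t * X i ω) := by
    intro t ω
    have h := convexOn_exp.map_sum_le (t := Finset.univ)
      (w := fun _ : ι => (Fintype.card ι : ℝ)⁻¹) (p := fun i => t * X i ω)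
      (fun _ _ => by positivity) (by simp [hcard.ne']) (fun _ _ => mem_univ _)
    simp only [smul_eq_mul, ← Finset.mul_sum] at h
    rwa [mul_left_comm] at h
  have hint : ∀ t : ℝ, Integrable
      (fun ω => (Fintype.card ι : ℝ)⁻¹ * ∑ i, Real.exp (t * X i ω)) μ := fun t =>
    (integrable_finsetSum _ fun i _ => (hX i).integrable_exp_mul t).const_mul _
  have hexp : ∀ t : ℝ, Integrable
      (fun ω => Real.exp (t * ((Fintype.card ι : ℝ)⁻¹ * ∑ i, X i ω))) μ := by
    intro t
    refine (hint t).mono' ?_ (ae_of_all _ fun ω => ?_)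
    · refine Real.continuous_exp.comp_aestronglyMeasurable ?_
      exact ((Finset.aestronglyMeasurable_fun_sum _
        fun i _ => (hX i).aestronglyMeasurable).const_mul _).const_mul _
    · rw [Real.norm_eq_abs, Real.abs_exp]
      exact hjensen t ω
  refine ⟨hexp, fun t => ?_⟩
  calc mgf (fun ω => (Fintype.card ι : ℝ)⁻¹ * ∑ i, X i ω) μ t
      ≤ ∫ ω, (Fintype.card ι : ℝ)⁻¹ * ∑ i, Real.exp (t * X i ω) ∂μ :=
        integral_mono (hexp t) (hint t) (hjensen t)
    _ = (Fintype.card ι : ℝ)⁻¹ * ∑ i, mgf (X i) μ t := by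
        rw [integral_const_mul, integral_finsetSum _ fun i _ => (hX i).integrable_exp_mul t]
        rfl
    _ ≤ (Fintype.card ι : ℝ)⁻¹ * ∑ _i : ι, Real.exp (c * t ^ 2 / 2) := by
        gcongr with i
        exact (hX i).mgf_le t
    _ = Real.exp (c * t ^ 2 / 2) := by
        rw [Finset.sum_const, Finset.card_univ, nsmul_eq_mul, inv_mul_cancel_left₀ hcard.ne']

/-! ### Concentration for the empirical product distribution. -/

section Samples

variable {n m : ℕ} {α : Fin n → Type*} [∀ i, MeasurableSpace (α i)]

/-- Permuting the samples of each coordinate separately preserves the law of i.i.d. samples from a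
product distribution. -/
theorem measurePreserving_permute_samples (D : ∀ i, Measure (α i))
    [∀ i, IsProbabilityMeasure (D i)] (σ : Fin n → Equiv.Perm (Fin m)) :
    MeasurePreserving (fun (x : Fin m → ∀ i, α i) (l : Fin m) (j : Fin n) => x (σ j l) j)
      (Measure.pi fun _ => Measure.pi D) (Measure.pi fun _ => Measure.pi D) := by
  have hmeas : Measurable
      (fun (x : Fin m → ∀ i, α i) (l : Fin m) (j : Fin n) => x (σ j l) j) := by fun_prop
  refine ⟨hmeas, ?_⟩
  symm
  -- Boxes form a generating π-system; the preimage of a box is a box with the same factors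
  -- reindexed by `σ`, hence of the same mass.
  refine Measure.pi_eq_generateFrom
    (C := fun _ => pi univ '' pi univ fun i => {s : Set (α i) | MeasurableSet s})
    (fun _ => generateFrom_pi) (fun _ => isPiSystem_pi) (fun _ => ?_) ?_
  · exact ⟨fun _ => univ, fun _ => ⟨fun _ => univ, fun _ _ => MeasurableSet.univ, by simp⟩,
      fun _ => by simp, by simp [iUnion_const]⟩
  · intro s hs
    choose S hS hSs using hs
    obtain rfl : s = fun l => pi univ (S l) := funext fun l => (hSs l).symm
    have hSm : ∀ l j, MeasurableSet (S l j) := fun l j => hS l j (mem_univ j)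
    rw [Measure.map_apply hmeas (MeasurableSet.univ_pi fun l => MeasurableSet.univ_pi (hSm l))]
    have hpre : (fun (x : Fin m → ∀ i, α i) (l : Fin m) (j : Fin n) => x (σ j l) j) ⁻¹'
        (pi univ fun l => pi univ (S l)) =
        pi univ fun k => pi univ fun j => S ((σ j).symm k) j := by
      ext x
      simp only [mem_preimage, mem_pi, mem_univ, true_implies]
      refine ⟨fun h k j => by simpa using h ((σ j).symm k) j, fun h l j => ?_⟩
      simpa using h (σ j l) j
    rw [hpre, Measure.pi_pi]
    simp only [Measure.pi_pi]
    rw [Finset.prod_comm, Finset.prod_comm (s := Finset.univ (α := Fin m))]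
    refine Finset.prod_congr rfl fun j _ => ?_
    exact Equiv.prod_comp (σ j).symm fun k => D j (S k j)

theorem empirical_eq_map {T : Fin n → Set ℝ} (x : Fin m → ∀ i, T i) (i : Fin n) :
    empirical x i = ((m : ℝ≥0∞)⁻¹ • Measure.count : Measure (Fin m)).map fun k => x k i := by
  rw [Measure.map_smul, Measure.count, Measure.map_sum (measurable_of_finite _).aemeasurable,
    Measure.sum_fintype, empirical]
  simp [Measure.map_dirac]

theorem isProbabilityMeasure_smul_count (hm : 0 < m) :
    IsProbabilityMeasure ((m : ℝ≥0∞)⁻¹ • Measure.count : Measure (Fin m)) := by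
  refine ⟨?_⟩
  rw [Measure.smul_apply, Measure.count_univ]
  simp [ENNReal.inv_mul_cancel, hm.ne']

theorem isProbabilityMeasure_empirical {T : Fin n → Set ℝ} (hm : 0 < m) (x : Fin m → ∀ i, T i)
    (i : Fin n) : IsProbabilityMeasure (empirical x i) := by
  have := isProbabilityMeasure_smul_count hm
  rw [empirical_eq_map]
  exact Measure.isProbabilityMeasure_map (measurable_of_finite _).aemeasurable

/-- The expectation under the empirical product distribution is the average over all ways to pick
one sample for each coordinate. -/
theorem integral_pi_empirical {T : Fin n → Set ℝ} (hm : 0 < m) (x : Fin m → ∀ i, T i)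
    {h : (∀ i, T i) → ℝ} (hh : Measurable h) :
    ∫ t, h t ∂(Measure.pi (empirical x)) =
      (Fintype.card (Fin n → Fin m) : ℝ)⁻¹ * ∑ k : Fin n → Fin m, h fun j => x (k j) j := by
  have := isProbabilityMeasure_smul_count hm
  have hmap : Measure.pi (empirical x) =
      (Measure.pi fun _ : Fin n => ((m : ℝ≥0∞)⁻¹ • Measure.count : Measure (Fin m))).map
        fun k j => x (k j) j := by
    have hx : ∀ i, IsProbabilityMeasure
        (((m : ℝ≥0∞)⁻¹ • Measure.count : Measure (Fin m)).map fun k => x k i) := fun i =>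
      Measure.isProbabilityMeasure_map (measurable_of_finite _).aemeasurable
    rw [Measure.pi_map_pi (f := fun i k => x k i)
      fun i => (measurable_of_finite _).aemeasurable]
    congr 1
    funext i
    exact empirical_eq_map x i
  rw [hmap, integral_map (measurable_of_finite _).aemeasurable hh.aestronglyMeasurable,
    integral_fintype Integrable.of_finite, Finset.mul_sum]
  refine Finset.sum_congr rfl fun k _ => ?_
  rw [smul_eq_mul, Measure.real, Measure.pi_singleton]
  simp

/-- The empirical product mean of a `[0, 1]`-valued function is sub-Gaussian, with the same
parameter as the mean of `m` i.i.d. samples. -/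
theorem hasSubgaussianMGF_empirical {T : Fin n → Set ℝ} (D : ∀ i, Measure (T i))
    [∀ i, IsProbabilityMeasure (D i)] (hm : 0 < m) {h : (∀ i, T i) → ℝ} (hh : Measurable h)
    (h01 : ∀ t, h t ∈ Icc (0 : ℝ) 1) :
    HasSubgaussianMGF (fun x : Fin m → ∀ i, T i =>
        m * (∫ t, h t ∂(Measure.pi (empirical x)) - ∫ t, h t ∂(Measure.pi D)))
      (m * (1 / 2) ^ 2) (Measure.pi fun _ => Measure.pi D) := by
  have : NeZero m := ⟨hm.ne'⟩
  set e := ∫ t, h t ∂(Measure.pi D)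
  have hone : HasSubgaussianMGF (fun t => h t - e) ((1 / 2) ^ 2) (Measure.pi D) := by
    simpa using hasSubgaussianMGF_of_mem_Icc (μ := Measure.pi D) hh.aemeasurable
      (ae_of_all _ h01)
  have hsum : HasSubgaussianMGF (fun x : Fin m → ∀ i, T i => ∑ l, (h (x l) - e))
      (m * (1 / 2) ^ 2) (Measure.pi fun _ => Measure.pi D) := by
    have hind : iIndepFun (fun (l : Fin m) (x : Fin m → ∀ i, T i) => h (x l) - e)
        (Measure.pi fun _ => Measure.pi D) :=
      iIndepFun_pi (X := fun _ t => h t - e) fun _ => (hh.sub_const e).aemeasurable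
    have hsub : ∀ l : Fin m, HasSubgaussianMGF (fun x : Fin m → ∀ i, T i => h (x l) - e)
        ((1 / 2) ^ 2) (Measure.pi fun _ => Measure.pi D) := by
      intro l
      have hev := measurePreserving_eval (fun _ : Fin m => Measure.pi D) l
      refine HasSubgaussianMGF.of_map (Y := Function.eval l) (X := fun t => h t - e)
        hev.measurable.aemeasurable ?_
      rwa [hev.map_eq]
    have := HasSubgaussianMGF.sum_of_iIndepFun hind (s := Finset.univ) fun l _ => hsub l
    simpa using this
  -- Cyclic shifts by `c j` in coordinate `j` give another family of `m` i.i.d. profiles.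
  have hshift : ∀ c : Fin n → Fin m, HasSubgaussianMGF
      (fun x : Fin m → ∀ i, T i => ∑ l, (h (fun j => x (l + c j) j) - e))
      (m * (1 / 2) ^ 2) (Measure.pi fun _ => Measure.pi D) := by
    intro c
    have hmp := measurePreserving_permute_samples (m := m) D fun j => Equiv.addRight (c j)
    refine HasSubgaussianMGF.of_map hmp.measurable.aemeasurable
      (X := fun x : Fin m → ∀ i, T i => ∑ l, (h (x l) - e)) ?_
    exact hmp.map_eq.symm ▸ hsum
  convert hasSubgaussianMGF_average hshift using 2 with x
  have hcard : (Fintype.card (Fin n → Fin m) : ℝ) ≠ 0 := by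
    exact_mod_cast Fintype.card_ne_zero
  -- For fixed `l`, the map `c ↦ l + c` is a bijection, so averaging over shifts visits every
  -- recombination once.
  have hl : ∀ l : Fin m, ∑ c : Fin n → Fin m, (h (fun j => x (l + c j) j) - e) =
      ∑ k : Fin n → Fin m, (h (fun j => x (k j) j) - e) := fun l =>
    Equiv.sum_comp (Equiv.addLeft (fun _ : Fin n => l))
      fun k : Fin n → Fin m => h (fun j => x (k j) j) - e
  rw [Finset.sum_comm, Finset.sum_congr rfl fun l _ => hl l, integral_pi_empirical hm x hh,
    Finset.sum_const, Finset.card_univ, Fintype.card_fin, nsmul_eq_mul, Finset.sum_sub_distrib,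
    Finset.sum_const, Finset.card_univ, nsmul_eq_mul, mul_left_comm, mul_sub (Fintype.card _ : ℝ)⁻¹,
    inv_mul_cancel_left₀ hcard]

/-- Hoeffding's inequality for the empirical product distribution. -/
theorem measure_empirical_deviation_le {T : Fin n → Set ℝ} (D : ∀ i, Measure (T i))
    [∀ i, IsProbabilityMeasure (D i)] (hm : 0 < m) {h : (∀ i, T i) → ℝ} (hh : Measurable h)
    (h01 : ∀ t, h t ∈ Icc (0 : ℝ) 1) {τ : ℝ} (hτ : 0 ≤ τ) :
    (Measure.pi fun _ : Fin m => Measure.pi D).real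
        {x | τ ≤ |∫ t, h t ∂(Measure.pi (empirical x)) - ∫ t, h t ∂(Measure.pi D)|}
      ≤ 2 * Real.exp (-(2 * m * τ ^ 2)) := by
  have hm' : (0 : ℝ) < m := by exact_mod_cast hm
  have hsub := hasSubgaussianMGF_empirical D hm hh h01
  have hexp : -(m * τ) ^ 2 / (2 * ((m * (1 / 2) ^ 2 : ℝ≥0) : ℝ)) = -(2 * m * τ ^ 2) := by
    push_cast
    field_simp
  have h1 := hsub.measure_ge_le (ε := m * τ) (by positivity)
  have h2 := hsub.neg.measure_ge_le (ε := m * τ) (by positivity)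
  rw [hexp] at h1 h2
  -- The two tails are bounded separately; this is the factor `2`.
  have hcover : {x : Fin m → ∀ i, T i |
        τ ≤ |∫ t, h t ∂(Measure.pi (empirical x)) - ∫ t, h t ∂(Measure.pi D)|} ⊆
      {x | m * τ ≤ m * (∫ t, h t ∂(Measure.pi (empirical x)) - ∫ t, h t ∂(Measure.pi D))} ∪
      {x | m * τ ≤ (-fun x : Fin m → ∀ i, T i =>
        m * (∫ t, h t ∂(Measure.pi (empirical x)) - ∫ t, h t ∂(Measure.pi D))) x} := by
    intro x hx
    rcases le_abs.1 (show τ ≤ |_| from hx) with h | h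
    · exact Or.inl (mul_le_mul_of_nonneg_left h hm'.le)
    · refine Or.inr ?_
      simp only [mem_ofPred_eq, Pi.neg_apply, ← mul_neg]
      exact mul_le_mul_of_nonneg_left h hm'.le
  calc _ ≤ _ := measureReal_mono hcover
    _ ≤ _ := measureReal_union_le _ _
    _ ≤ _ := by linarith

end Samples

/-! ### Bracketing lower sets of a line. -/

section Brackets

/-- If `r` has no maximum on `S`, then `S` is exhausted by a countable directed family of strict
sublevel sets with rational thresholds, and continuity from below applies. This makes the brackets
valid in the presence of atoms. -/
theorem measure_le_of_forall_sublevel {α : Type*} [MeasurableSpace α] (μ : Measure α) (r : α → ℝ)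
    (S : Set α) (c : ℝ≥0∞) (h : ∀ s ∈ S, μ {t | r t ≤ r s} ≤ c) : μ S ≤ c := by
  by_cases hmax : ∃ s ∈ S, ∀ t ∈ S, r t ≤ r s
  · obtain ⟨s, hs, hle⟩ := hmax
    exact (measure_mono fun t ht => hle t ht).trans (h s hs)
  · push Not at hmax
    have hcover : S ⊆ ⋃ q ∈ {q : ℚ | ∃ s ∈ S, (q : ℝ) < r s}, {t | r t < q} := by
      intro t ht
      obtain ⟨s, hs, hts⟩ := hmax t ht
      obtain ⟨q, hq1, hq2⟩ := exists_rat_btwn hts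
      exact mem_biUnion (x := q) ⟨s, hs, hq2⟩ hq1
    refine (measure_mono hcover).trans ?_
    rw [measure_biUnion_eq_iSup (to_countable _)]
    · refine iSup₂_le fun q ⟨s, hs, hq⟩ => (measure_mono fun t ht => ?_).trans (h s hs)
      exact (lt_trans (show r t < q from ht) hq).le
    · intro p hp q hq
      rcases le_total p q with hpq | hpq
      · exact ⟨q, hq, fun t (ht : r t < p) => lt_of_lt_of_le ht (by exact_mod_cast hpq),
          fun t ht => ht⟩
      · exact ⟨p, hp, fun t ht => ht,
          fun t (ht : r t < q) => lt_of_lt_of_le ht (by exact_mod_cast hpq)⟩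

variable {T : Set ℝ}

theorem _root_.IsLowerSet.measurableSet_subtype {A : Set T} (hA : IsLowerSet A) :
    MeasurableSet A :=
  hA.ordConnected.measurableSet

/-- The `k`-th bracket of lower sets at resolution `1 / K`: its upper end (`true`) and its lower
end (`false`). -/
def bracket (D : Measure T) (K k : ℕ) (upper : Bool) : Set T :=
  if upper then {t | D.real (Iic t) ≤ k / K} else {t | D.real (Iio t) ≤ (k - 1) / K}

theorem isLowerSet_bracket (D : Measure T) [IsProbabilityMeasure D] (K k : ℕ) (upper : Bool) :
    IsLowerSet (bracket D K k upper) := by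
  intro a b hba ha
  cases upper
  · exact (measureReal_mono (Iio_subset_Iio hba)).trans
      (show D.real (Iio a) ≤ ((k : ℝ) - 1) / K from ha)
  · exact (measureReal_mono (Iic_subset_Iic.2 hba)).trans
      (show D.real (Iic a) ≤ (k : ℝ) / K from ha)

/-- The bracket index is the mass of `A` rounded up to a multiple of `1 / K`. The ends are defined
by the masses of `Iic t` and `Iio t`, so that an atom at the boundary of `A` lies in the gap only
when it is light. -/
theorem exists_bracket (D : Measure T) [IsProbabilityMeasure D] {K : ℕ} (hK : 0 < K) {A : Set T}
    (hA : IsLowerSet A) :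
    ∃ k : Fin (K + 1), bracket D K k false ⊆ A ∧ A ⊆ bracket D K k true ∧
      D.real (bracket D K k true \ bracket D K k false) ≤ 1 / K := by
  have hK' : (0 : ℝ) < K := by exact_mod_cast hK
  have hA0 : 0 ≤ D.real A := measureReal_nonneg
  have hA1 : D.real A ≤ 1 := measureReal_le_one
  set k := ⌈K * D.real A⌉₊
  have hkK : k ≤ K := Nat.ceil_le.2 (by nlinarith)
  have hup : D.real A ≤ k / K := by
    rw [le_div_iff₀ hK', mul_comm]
    exact Nat.le_ceil _
  have hlow : ((k : ℝ) - 1) / K < D.real A := by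
    rw [div_lt_iff₀ hK', mul_comm]
    have := Nat.ceil_lt_add_one (mul_nonneg hK'.le hA0)
    linarith
  -- A point outside `A` has all of `A` strictly below it. For `k = 0` the threshold is negative and
  -- the lower end is empty.
  have hLA : bracket D K k false ⊆ A := by
    intro t (ht : D.real (Iio t) ≤ ((k : ℝ) - 1) / K)
    by_contra htA
    have hsub : A ⊆ Iio t := fun a ha => lt_of_not_ge fun hta => htA (hA hta ha)
    linarith [measureReal_mono (μ := D) hsub]
  have hAU : A ⊆ bracket D K k true := fun t ht =>
    (measureReal_mono (μ := D) (show Iic t ⊆ A from fun a ha => hA ha ht)).trans hup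
  refine ⟨⟨k, by omega⟩, hLA, hAU, ?_⟩
  have hU : D.real (bracket D K k true) ≤ k / K := by
    refine ENNReal.toReal_le_of_le_ofReal (by positivity) ?_
    refine measure_le_of_forall_sublevel D (fun t => (t : ℝ)) _ _ fun s hs => ?_
    have hs' : D.real (Iic s) ≤ (k : ℝ) / K := hs
    have : {t : T | (t : ℝ) ≤ s} = Iic s := rfl
    rw [this, ← ofReal_measureReal]
    exact ENNReal.ofReal_le_ofReal hs'
  have hmL := (isLowerSet_bracket D K k false).measurableSet_subtype
  have hLc : D.real (bracket D K k false)ᶜ ≤ 1 - ((k : ℝ) - 1) / K := by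
    refine ENNReal.toReal_le_of_le_ofReal (by linarith) ?_
    refine measure_le_of_forall_sublevel D (fun t => -(t : ℝ)) _ _ fun s hs => ?_
    have hs' : ((k : ℝ) - 1) / K < D.real (Iio s) := lt_of_not_ge hs
    have : {t : T | -(t : ℝ) ≤ -s} = (Iio s)ᶜ := by
      ext t
      simp
    rw [this, ← ofReal_measureReal, probReal_compl_eq_one_sub measurableSet_Iio]
    exact ENNReal.ofReal_le_ofReal (by linarith)
  rw [probReal_compl_eq_one_sub hmL] at hLc
  rw [measureReal_sdiff (hLA.trans hAU) hmL]
  have : (k : ℝ) / K - ((k : ℝ) - 1) / K = 1 / K := by ring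
  linarith

end Brackets

/-! ### The winning probability as a function of two families of sets. -/

section TieShare

variable {n : ℕ} {α : Fin n → Type*}

open Classical in
/-- The winning probability of bidder `i` when `A j` are the values of bidder `j` at which she bids
at most as much as `i`, and `B j` those at which she bids less. -/
noncomputable def tieShare (i : Fin n) (A B : ∀ j, Set (α j)) (t : ∀ j, α j) : ℝ :=
  if ∀ j, j ≠ i → t j ∈ A j then
    1 / (1 + ∑ j ∈ Finset.univ.erase i, (B j)ᶜ.indicator (fun _ => (1 : ℝ)) (t j))
  else 0

theorem tieShare_denom_pos (i : Fin n) (B : ∀ j, Set (α j)) (t : ∀ j, α j) :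
    (1 : ℝ) ≤ 1 + ∑ j ∈ Finset.univ.erase i, (B j)ᶜ.indicator (fun _ => (1 : ℝ)) (t j) := by
  have : 0 ≤ ∑ j ∈ Finset.univ.erase i, (B j)ᶜ.indicator (fun _ => (1 : ℝ)) (t j) :=
    Finset.sum_nonneg fun j _ => indicator_nonneg (fun _ _ => zero_le_one' ℝ) _
  linarith

theorem tieShare_mem_Icc (i : Fin n) (A B : ∀ j, Set (α j)) (t : ∀ j, α j) :
    tieShare i A B t ∈ Icc (0 : ℝ) 1 := by
  have h := tieShare_denom_pos i B t
  unfold tieShare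
  split_ifs
  · exact ⟨by positivity, (div_le_one (by linarith)).2 h⟩
  · simp

/-- Larger `A` makes winning more likely and larger `B` leaves fewer ties. No relation between `A`
and `B` is needed, so the two families can be bracketed independently. -/
theorem tieShare_mono (i : Fin n) {A A' B B' : ∀ j, Set (α j)} (hA : ∀ j, A j ⊆ A' j)
    (hB : ∀ j, B j ⊆ B' j) (t : ∀ j, α j) : tieShare i A B t ≤ tieShare i A' B' t := by
  by_cases h : ∀ j, j ≠ i → t j ∈ A j
  · have h' : ∀ j, j ≠ i → t j ∈ A' j := fun j hj => hA j (h j hj)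
    rw [tieShare, tieShare, if_pos h, if_pos h']
    refine one_div_le_one_div_of_le (by linarith [tieShare_denom_pos i B' t]) ?_
    gcongr with j hj
    exact hB j
  · rw [tieShare, if_neg h]
    exact (tieShare_mem_Icc i A' B' t).1

/-- Either some coordinate lies in a gap, and the sum is at least `1`, or no membership changes and
both shares coincide. -/
theorem tieShare_sub_le (i : Fin n) {A A' B B' : ∀ j, Set (α j)} (hA : ∀ j, A j ⊆ A' j)
    (hB : ∀ j, B j ⊆ B' j) (t : ∀ j, α j) :
    tieShare i A' B' t - tieShare i A B t ≤
      ∑ j, ((A' j \ A j).indicator (fun _ => (1 : ℝ)) (t j) +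
        (B' j \ B j).indicator (fun _ => (1 : ℝ)) (t j)) := by
  have hnn : ∀ j, 0 ≤ (A' j \ A j).indicator (fun _ => (1 : ℝ)) (t j) +
      (B' j \ B j).indicator (fun _ => (1 : ℝ)) (t j) := fun j =>
    add_nonneg (indicator_nonneg (fun _ _ => zero_le_one) _)
      (indicator_nonneg (fun _ _ => zero_le_one) _)
  by_cases h : ∃ j, t j ∈ A' j \ A j ∨ t j ∈ B' j \ B j
  · obtain ⟨j, hj⟩ := h
    have h1 : 1 ≤ (A' j \ A j).indicator (fun _ => (1 : ℝ)) (t j) +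
        (B' j \ B j).indicator (fun _ => (1 : ℝ)) (t j) := by
      rcases hj with hj | hj
      · rw [indicator_of_mem hj]
        linarith [indicator_nonneg (s := B' j \ B j) (f := fun _ => (1 : ℝ))
          (fun _ _ => zero_le_one) (t j)]
      · rw [indicator_of_mem hj]
        linarith [indicator_nonneg (s := A' j \ A j) (f := fun _ => (1 : ℝ))
          (fun _ _ => zero_le_one) (t j)]
    have h2 := Finset.single_le_sum (fun j _ => hnn j) (Finset.mem_univ j)
    linarith [(tieShare_mem_Icc i A' B' t).2, (tieShare_mem_Icc i A B t).1]
  · push Not at h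
    have hAA : ∀ j, t j ∈ A j ↔ t j ∈ A' j := fun j =>
      ⟨fun hj => hA j hj, fun hj => by_contra fun hn => (h j).1 ⟨hj, hn⟩⟩
    have hBB : ∀ j, t j ∈ B j ↔ t j ∈ B' j := fun j =>
      ⟨fun hj => hB j hj, fun hj => by_contra fun hn => (h j).2 ⟨hj, hn⟩⟩
    have heq : tieShare i A' B' t = tieShare i A B t := by
      have hB' : ∀ j, (B' j)ᶜ.indicator (fun _ => (1 : ℝ)) (t j) =
          (B j)ᶜ.indicator (fun _ => (1 : ℝ)) (t j) := fun j => by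
        by_cases hj : t j ∈ B j
        · simp [hj, (hBB j).1 hj]
        · simp [hj, mt (hBB j).2 hj]
      unfold tieShare
      classical
      refine if_congr (forall₂_congr fun j _ => (hAA j).symm) ?_ rfl
      simp only [hB']
    rw [heq, sub_self]
    exact Finset.sum_nonneg fun j _ => hnn j

variable [∀ j, MeasurableSpace (α j)]

theorem measurable_tieShare (i : Fin n) {A B : ∀ j, Set (α j)} (hA : ∀ j, MeasurableSet (A j))
    (hB : ∀ j, MeasurableSet (B j)) : Measurable (tieShare i A B) := by
  classical
  refine Measurable.ite ?_ ?_ measurable_const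
  · have : {t : ∀ j, α j | ∀ j, j ≠ i → t j ∈ A j} =
        ⋂ j, ⋂ _ : j ≠ i, Function.eval j ⁻¹' A j := by
      ext t
      simp
    rw [this]
    exact MeasurableSet.iInter fun j => MeasurableSet.iInter fun _ => measurable_pi_apply j (hA j)
  · refine measurable_const.div (measurable_const.add (Finset.measurable_fun_sum _ fun j _ => ?_))
    exact (measurable_const.indicator (hB j).compl).comp (measurable_pi_apply j)

theorem integrable_tieShare (D : ∀ j, Measure (α j)) [∀ j, IsProbabilityMeasure (D j)]
    (i : Fin n) {A B : ∀ j, Set (α j)} (hA : ∀ j, MeasurableSet (A j))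
    (hB : ∀ j, MeasurableSet (B j)) : Integrable (tieShare i A B) (Measure.pi D) :=
  Integrable.of_mem_Icc 0 1 (measurable_tieShare i hA hB).aemeasurable
    (ae_of_all _ (tieShare_mem_Icc i A B))

theorem integral_tieShare_sub_le (D : ∀ j, Measure (α j)) [∀ j, IsProbabilityMeasure (D j)]
    (i : Fin n) {A A' B B' : ∀ j, Set (α j)} (hA : ∀ j, A j ⊆ A' j) (hB : ∀ j, B j ⊆ B' j)
    (hmA : ∀ j, MeasurableSet (A j)) (hmA' : ∀ j, MeasurableSet (A' j))
    (hmB : ∀ j, MeasurableSet (B j)) (hmB' : ∀ j, MeasurableSet (B' j)) :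
    ∫ t, tieShare i A' B' t ∂(Measure.pi D) - ∫ t, tieShare i A B t ∂(Measure.pi D) ≤
      ∑ j, ((D j).real (A' j \ A j) + (D j).real (B' j \ B j)) := by
  have hind : ∀ j {S : Set (α j)}, MeasurableSet S →
      Integrable (fun t : ∀ j, α j => S.indicator (fun _ => (1 : ℝ)) (t j)) (Measure.pi D) ∧
      ∫ t, S.indicator (fun _ => (1 : ℝ)) (t j) ∂(Measure.pi D) = (D j).real S := by
    intro j S hS
    have hev := measurePreserving_eval D j
    have hint : Integrable (S.indicator fun _ => (1 : ℝ)) (D j) :=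
      (integrable_const 1).indicator hS
    refine ⟨hev.integrable_comp_of_integrable hint, ?_⟩
    have := integral_map (μ := Measure.pi D) (φ := Function.eval j) hev.measurable.aemeasurable
      (f := S.indicator fun _ => (1 : ℝ)) (hev.map_eq.symm ▸ hint.aestronglyMeasurable)
    rw [hev.map_eq, integral_indicator_const _ hS] at this
    simpa using this.symm
  rw [← integral_sub (integrable_tieShare D i hmA' hmB') (integrable_tieShare D i hmA hmB)]
  have hsum : ∀ j ∈ Finset.univ, Integrable (fun t : ∀ j, α j =>
      (A' j \ A j).indicator (fun _ => (1 : ℝ)) (t j) +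
        (B' j \ B j).indicator (fun _ => (1 : ℝ)) (t j)) (Measure.pi D) := fun j _ =>
    (hind j ((hmA' j).diff (hmA j))).1.add (hind j ((hmB' j).diff (hmB j))).1
  calc _ ≤ ∫ t : ∀ j, α j, ∑ j, ((A' j \ A j).indicator (fun _ => (1 : ℝ)) (t j) +
        (B' j \ B j).indicator (fun _ => (1 : ℝ)) (t j)) ∂(Measure.pi D) :=
        integral_mono ((integrable_tieShare D i hmA' hmB').sub (integrable_tieShare D i hmA hmB))
          (integrable_finsetSum _ hsum) (tieShare_sub_le i hA hB)
    _ = _ := by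
        rw [integral_finsetSum _ hsum]
        refine Finset.sum_congr rfl fun j _ => ?_
        rw [integral_add (hind j ((hmA' j).diff (hmA j))).1 (hind j ((hmB' j).diff (hmB j))).1,
          (hind j ((hmA' j).diff (hmA j))).2, (hind j ((hmB' j).diff (hmB j))).2]

end TieShare

/-! ### Union bound over brackets. -/

section UniformConvergence

variable {n m : ℕ} {T : Fin n → Set ℝ}

/-- Uniform convergence of the expected winning probabilities over all families of lower sets. -/
theorem exists_event_uniform_tieShare (D : ∀ i, Measure (T i)) [∀ i, IsProbabilityMeasure (D i)]
    (hm : 0 < m) {K : ℕ} (hK : 0 < K) {τ : ℝ} (hτ : 0 ≤ τ) :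
    ∃ E : Set (Fin m → ∀ i, T i), MeasurableSet E ∧
      (Measure.pi fun _ : Fin m => Measure.pi D).real Eᶜ ≤
        (n * (2 * ((K + 1) ^ n * (K + 1) ^ n))) * (2 * Real.exp (-(2 * m * τ ^ 2))) ∧
      ∀ x ∈ E, ∀ (i : Fin n) (A B : ∀ j, Set (T j)), (∀ j, IsLowerSet (A j)) →
        (∀ j, IsLowerSet (B j)) →
        |∫ t, tieShare i A B t ∂(Measure.pi (empirical x)) -
          ∫ t, tieShare i A B t ∂(Measure.pi D)| ≤ τ + 2 * n / K := by
  -- A test function is given by a bidder, an end of the bracket, and one bracket index per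
  -- coordinate for each of `A` and `B`. The brackets come from `D`, so the test functions do not
  -- depend on the sample.
  let ι := Fin n × Bool × (Fin n → Fin (K + 1)) × (Fin n → Fin (K + 1))
  let br : Bool → (Fin n → Fin (K + 1)) → ∀ j, Set (T j) := fun u k j => bracket (D j) K (k j) u
  let h : ι → (∀ j, T j) → ℝ := fun p => tieShare p.1 (br p.2.1 p.2.2.1) (br p.2.1 p.2.2.2)
  have hbr : ∀ u k j, MeasurableSet (br u k j) := fun u k j =>
    (isLowerSet_bracket (D j) K (k j) u).measurableSet_subtype
  have hh : ∀ p, Measurable (h p) := fun p => measurable_tieShare _ (hbr _ _) (hbr _ _)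
  let bad : ι → Set (Fin m → ∀ i, T i) := fun p =>
    {x | τ ≤ |∫ t, h p t ∂(Measure.pi (empirical x)) - ∫ t, h p t ∂(Measure.pi D)|}
  have hbad : ∀ p, MeasurableSet (bad p) := by
    intro p
    refine measurableSet_le measurable_const (Measurable.abs (Measurable.sub_const ?_ _))
    simp_rw [integral_pi_empirical hm _ (hh p)]
    have := hh p
    exact measurable_const.mul (Finset.measurable_fun_sum _ fun k _ => this.comp (by fun_prop))
  refine ⟨(⋃ p, bad p)ᶜ, (MeasurableSet.iUnion hbad).compl, ?_, ?_⟩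
  · rw [compl_compl]
    calc _ ≤ ∑ p, (Measure.pi fun _ : Fin m => Measure.pi D).real (bad p) :=
          measureReal_iUnion_fintype_le _
      _ ≤ ∑ _p : ι, 2 * Real.exp (-(2 * m * τ ^ 2)) :=
          Finset.sum_le_sum fun p _ =>
            measure_empirical_deviation_le D hm (hh p) (fun t => tieShare_mem_Icc _ _ _ t) hτ
      _ = _ := by simp [ι]
  · intro x hx i A B hA hB
    have := isProbabilityMeasure_empirical hm x
    have hgood : ∀ p, |∫ t, h p t ∂(Measure.pi (empirical x)) - ∫ t, h p t ∂(Measure.pi D)| ≤ τ :=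
      fun p => le_of_lt (lt_of_not_ge fun hp => hx (mem_iUnion.2 ⟨p, hp⟩))
    choose k hkL hkU hk using fun j => exists_bracket (D j) hK (hA j)
    choose l hlL hlU hl using fun j => exists_bracket (D j) hK (hB j)
    have hmA := fun j => (hA j).measurableSet_subtype
    have hmB := fun j => (hB j).measurableSet_subtype
    have hlow := hgood (i, false, k, l)
    have hupp := hgood (i, true, k, l)
    have hmono : ∀ (μ : ∀ j, Measure (T j)) [∀ j, IsProbabilityMeasure (μ j)],
        ∫ t, h (i, false, k, l) t ∂(Measure.pi μ) ≤ ∫ t, tieShare i A B t ∂(Measure.pi μ) ∧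
        ∫ t, tieShare i A B t ∂(Measure.pi μ) ≤ ∫ t, h (i, true, k, l) t ∂(Measure.pi μ) :=
      fun μ _ =>
        ⟨integral_mono (integrable_tieShare μ i (hbr _ _) (hbr _ _))
            (integrable_tieShare μ i hmA hmB) (tieShare_mono i hkL hlL),
          integral_mono (integrable_tieShare μ i hmA hmB)
            (integrable_tieShare μ i (hbr _ _) (hbr _ _)) (tieShare_mono i hkU hlU)⟩
    -- The width is needed under `D` only; under the empirical product the sandwich uses inclusions
    -- and the closeness of the two ends.
    have hwidth : ∫ t, h (i, true, k, l) t ∂(Measure.pi D) -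
        ∫ t, h (i, false, k, l) t ∂(Measure.pi D) ≤ 2 * n / K := by
      refine (integral_tieShare_sub_le D i (fun j => (hkL j).trans (hkU j))
        (fun j => (hlL j).trans (hlU j)) (hbr _ _) (hbr _ _) (hbr _ _) (hbr _ _)).trans ?_
      calc _ ≤ ∑ _j : Fin n, ((1 : ℝ) / K + 1 / K) :=
            Finset.sum_le_sum fun j _ => add_le_add (hk j) (hl j)
        _ = 2 * n / K := by
            rw [Finset.sum_const, Finset.card_univ, Fintype.card_fin, nsmul_eq_mul]
            ring
    obtain ⟨hD1, hD2⟩ := hmono D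
    obtain ⟨hE1, hE2⟩ := hmono (empirical x)
    rw [abs_le] at hlow hupp ⊢
    constructor <;> linarith

end UniformConvergence

/-! ### Winning probabilities and interim utilities. -/

section WinProb

variable {n m : ℕ} {T : Fin n → Set ℝ} {H : ℝ}

theorem alloc_update (i : Fin n) (b : Bid H) (s : JointStrategy T H) (t : ∀ j, T j) :
    alloc i (Function.update (fun j => s j (t j)) i b) =
      tieShare i (fun j => {t | s j t ≤ b}) (fun j => {t | s j t < b}) t := by
  classical
  have hcond : (∀ j, Function.update (fun j => s j (t j)) i b j ≤
      Function.update (fun j => s j (t j)) i b i) ↔ ∀ j, j ≠ i → s j (t j) ≤ b := by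
    refine ⟨fun h j hj => by simpa [hj] using h j, fun h j => ?_⟩
    by_cases hj : j = i
    · rw [hj]
    · simpa [hj] using h j hj
  by_cases h : ∀ j, j ≠ i → s j (t j) ≤ b
  · have hmax := hcond.2 h
    -- When `i` bids highest, the set of winners is `i` together with the rivals not bidding below
    -- `b`.
    have hfilter : (Finset.univ.filter fun j : Fin n =>
        ∀ k, Function.update (fun j => s j (t j)) i b k ≤
          Function.update (fun j => s j (t j)) i b j) =
        insert i ((Finset.univ.erase i).filter fun j => ¬ s j (t j) < b) := by
      ext j
      by_cases hj : j = i
      · subst hj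
        simpa using hmax
      · simp only [Finset.mem_filter, Finset.mem_univ, true_and, Finset.mem_insert, hj, false_or,
          Finset.mem_erase, ne_eq, not_false_eq_true, not_lt]
        refine ⟨fun hk => by simpa [hj] using hk i, fun hb k => (hmax k).trans ?_⟩
        simpa [hj] using hb
    have hsum : ∑ j ∈ Finset.univ.erase i,
        ({t | s j t < b} : Set (T j))ᶜ.indicator (fun _ => (1 : ℝ)) (t j) =
        (((Finset.univ.erase i).filter fun j => ¬ s j (t j) < b).card : ℝ) := by
      rw [← Finset.sum_boole]
      refine Finset.sum_congr rfl fun j _ => ?_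
      by_cases hj : s j (t j) < b
      · rw [if_neg (not_not.2 hj), indicator_of_notMem (not_not.2 hj)]
      · rw [if_pos hj, indicator_of_mem hj]
    refine (if_pos hmax).trans (Eq.trans ?_ (if_pos h).symm)
    rw [hsum]
    have hcard := congrArg Finset.card hfilter
    rw [Finset.card_insert_of_notMem (by simp)] at hcard
    congr 1
    rw [add_comm]
    exact_mod_cast hcard
  · exact (if_neg (mt hcond.1 h)).trans (if_neg h).symm

/-- The probability that bidder `i` wins with bid `b` against the others playing `s`. -/
noncomputable def winProb (D : ∀ i, Measure (T i)) (i : Fin n) (b : Bid H)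
    (s : JointStrategy T H) : ℝ :=
  ∫ t : (∀ j, T j), alloc i (Function.update (fun j => s j (t j)) i b) ∂(Measure.pi D)

theorem winProb_eq (D : ∀ i, Measure (T i)) (i : Fin n) (b : Bid H) (s : JointStrategy T H) :
    winProb D i b s = ∫ t, tieShare i (fun j => {t | s j t ≤ b}) (fun j => {t | s j t < b}) t
      ∂(Measure.pi D) := by
  simp only [winProb, alloc_update]

theorem isLowerSet_bid_le {S : Set ℝ} {s : S → Bid H} (hs : Monotone s) (b : Bid H) :
    IsLowerSet {t | s t ≤ b} := fun _ _ hvw hw => (hs hvw).trans hw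

theorem isLowerSet_bid_lt {S : Set ℝ} {s : S → Bid H} (hs : Monotone s) (b : Bid H) :
    IsLowerSet {t | s t < b} := fun _ _ hvw hw => (hs hvw).trans_lt hw

theorem measurable_alloc_update {s : JointStrategy T H} (hs : ∀ i, Monotone (s i)) (i : Fin n)
    (b : Bid H) :
    Measurable fun t : (∀ j, T j) => alloc i (Function.update (fun j => s j (t j)) i b) := by
  simp only [alloc_update]
  exact measurable_tieShare i (fun j => (isLowerSet_bid_le (hs j) b).measurableSet_subtype)
    (fun j => (isLowerSet_bid_lt (hs j) b).measurableSet_subtype)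

theorem alloc_mem_Icc (i : Fin n) (b : Fin n → Bid H) : alloc i b ∈ Icc (0 : ℝ) 1 := by
  unfold alloc
  split_ifs with h
  · have hcard : 0 < (Finset.univ.filter fun j : Fin n => ∀ k, b k ≤ b j).card :=
      Finset.card_pos.2 ⟨i, by simpa using h⟩
    refine ⟨by positivity, ?_⟩
    rw [div_le_one (by exact_mod_cast hcard)]
    exact_mod_cast hcard
  · simp

variable {s : JointStrategy T H} (D : ∀ i, Measure (T i)) [∀ i, IsProbabilityMeasure (D i)]

theorem integrable_alloc_update (hs : ∀ i, Monotone (s i)) (i : Fin n) (b : Bid H) :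
    Integrable (fun t : (∀ j, T j) => alloc i (Function.update (fun j => s j (t j)) i b))
      (Measure.pi D) :=
  Integrable.of_mem_Icc 0 1 (measurable_alloc_update hs i b).aemeasurable
    (ae_of_all _ fun _ => alloc_mem_Icc _ _)

theorem winProb_mem_Icc (hs : ∀ i, Monotone (s i)) (i : Fin n) (b : Bid H) :
    winProb D i b s ∈ Icc (0 : ℝ) 1 := by
  refine ⟨integral_nonneg fun t => (alloc_mem_Icc _ _).1, ?_⟩
  have := integral_mono (integrable_alloc_update D hs i b) (integrable_const (1 : ℝ))
    fun t => (alloc_mem_Icc i (Function.update (fun j => s j (t j)) i b)).2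
  simpa [winProb] using this

theorem winProb_mono (hs : ∀ i, Monotone (s i)) (i : Fin n) {b b' : Bid H} (hb : b ≤ b') :
    winProb D i b s ≤ winProb D i b' s := by
  refine integral_mono (integrable_alloc_update D hs i b) (integrable_alloc_update D hs i b')
    fun t => ?_
  simp only [alloc_update]
  exact tieShare_mono i (fun j v (hv : s j v ≤ b) => hv.trans hb)
    (fun j v (hv : s j v < b) => hv.trans_le hb) t

theorem interimUtility_eq (f g : Fin n → Bid H → Bid H) (hs : ∀ i, Monotone (s i)) (i : Fin n)
    (v : T i) (b : Bid H) :
    interimUtility f g D i v b s = ((v : ℝ) - f i b) * winProb D i b s - g i b := by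
  have hint := (integrable_alloc_update D hs i b).const_mul ((v : ℝ) - f i b)
  have hpt : ∀ t : (∀ j, T j),
      exPostUtility f g i (v : ℝ) (Function.update (fun j => s j (t j)) i b) =
      ((v : ℝ) - f i b) * alloc i (Function.update (fun j => s j (t j)) i b) - g i b := by
    intro t
    simp only [exPostUtility, payment, Function.update_self]
    ring
  simp only [interimUtility, hpt]
  rw [integral_sub hint (integrable_const _), integral_const_mul, integral_const, winProb]
  simp

/-- With a single bidder the item is always won. -/
theorem winProb_eq_one_of_subsingleton [Subsingleton (Fin n)] (i : Fin n) (b : Bid H)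
    (s : JointStrategy T H) : winProb D i b s = 1 := by
  have : ∀ t : (∀ j, T j), alloc i (Function.update (fun j => s j (t j)) i b) = 1 := by
    intro t
    rw [alloc_update, tieShare, if_pos fun j hj => absurd (Subsingleton.elim j i) hj,
      Finset.sum_eq_zero fun j hj =>
        absurd (Subsingleton.elim j i) (Finset.ne_of_mem_erase hj)]
    norm_num
  simp [winProb, this]

/-- Uniform convergence of the winning probabilities over monotone strategies. -/
theorem exists_event_uniform_winProb (H : ℝ) (hm : 0 < m) {K : ℕ} (hK : 0 < K) {τ : ℝ}
    (hτ : 0 ≤ τ) :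
    ∃ E : Set (Fin m → ∀ i, T i), MeasurableSet E ∧
      (Measure.pi fun _ : Fin m => Measure.pi D).real Eᶜ ≤
        (n * (2 * ((K + 1) ^ n * (K + 1) ^ n))) * (2 * Real.exp (-(2 * m * τ ^ 2))) ∧
      ∀ x ∈ E, ∀ (s : JointStrategy T H), (∀ i, Monotone (s i)) → ∀ (i : Fin n) (b : Bid H),
        |winProb (empirical x) i b s - winProb D i b s| ≤ τ + 2 * n / K := by
  obtain ⟨E, hE, hμ, hx⟩ := exists_event_uniform_tieShare D hm hK hτ
  refine ⟨E, hE, hμ, fun x hxE s hs i b => ?_⟩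
  rw [winProb_eq, winProb_eq]
  exact hx x hxE i _ _ (fun j => isLowerSet_bid_le (hs j) b) (fun j => isLowerSet_bid_lt (hs j) b)

/-- Every product distribution is approximated by empirical ones, uniformly over monotone
strategies. -/
theorem exists_empirical_approx (H : ℝ) {η : ℝ} (hη : 0 < η) :
    ∃ m : ℕ, 0 < m ∧ ∃ x : Fin m → ∀ i, T i,
      ∀ (s : JointStrategy T H), (∀ i, Monotone (s i)) → ∀ (i : Fin n) (b : Bid H),
        |winProb (empirical x) i b s - winProb D i b s| ≤ η := by
  obtain ⟨K, hK⟩ := exists_nat_gt (4 * n / η)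
  have hK0 : (0 : ℝ) < K := lt_of_le_of_lt (by positivity) hK
  have hKη : 2 * n / K ≤ η / 2 := by
    rw [div_lt_iff₀ hη] at hK
    rw [div_le_iff₀ hK0]
    linarith
  have hlim : Filter.Tendsto (fun m : ℕ => (n * (2 * (((K : ℝ) + 1) ^ n * (K + 1) ^ n))) *
      (2 * Real.exp (-(2 * m * (η / 2) ^ 2)))) Filter.atTop (nhds 0) := by
    have h1 : Filter.Tendsto (fun m : ℕ => 2 * (m : ℝ) * (η / 2) ^ 2) Filter.atTop
        Filter.atTop :=
      (tendsto_natCast_atTop_atTop.const_mul_atTop two_pos).atTop_mul_const (by positivity)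
    have h2 := (Real.tendsto_exp_neg_atTop_nhds_zero.comp h1).const_mul 2
    simpa using h2.const_mul (n * (2 * (((K : ℝ) + 1) ^ n * (K + 1) ^ n)))
  obtain ⟨m, hlt, hm⟩ :=
    ((hlim.eventually_lt_const one_pos).and (Filter.eventually_gt_atTop 0)).exists
  obtain ⟨E, hE, hμ, hx⟩ := exists_event_uniform_winProb D H hm (K := K)
    (by exact_mod_cast hK0) (half_pos hη).le
  -- Probabilistic method: an empty good event would have a complement of mass `1`.
  have hne : E.Nonempty := by
    rw [nonempty_iff_ne_empty]
    rintro rfl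
    rw [compl_empty, probReal_univ] at hμ
    linarith
  obtain ⟨x, hxE⟩ := hne
  exact ⟨m, hm, x, fun s hs i b => (hx x hxE s hs i b).trans (by linarith)⟩

theorem measurable_alloc (i : Fin n) : Measurable (alloc (H := H) i) := by
  classical
  have hle : ∀ j, MeasurableSet {b : Fin n → Bid H | ∀ k, b k ≤ b j} := by
    intro j
    have : {b : Fin n → Bid H | ∀ k, b k ≤ b j} = ⋂ k, {b | b k ≤ b j} := by
      ext b
      simp
    rw [this]
    exact MeasurableSet.iInter fun k =>
      measurableSet_le (measurable_pi_apply k) (measurable_pi_apply j)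
  refine Measurable.ite (hle i) ?_ measurable_const
  refine measurable_const.div ?_
  simp_rw [Finset.card_filter, Nat.cast_sum]
  refine Finset.measurable_fun_sum _ fun j _ => ?_
  simp only [Nat.cast_ite, Nat.cast_one, Nat.cast_zero]
  exact Measurable.ite (hle j) measurable_const measurable_const

/-- Under an empirical product, the winning probability of a monotone strategy is a finite average
involving recommended bids at finitely many values, which are random variables by assumption. -/
theorem aestronglyMeasurable_winProb_empirical (hm : 0 < m) (x : Fin m → ∀ i, T i)
    (Q : StrategyDist T H) (hQ : Q.IsMonotone) (i : Fin n) (β : JointStrategy T H → Bid H)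
    (hβ : Measurable[Q.events] β) :
    AEStronglyMeasurable[Q.events] (fun s => winProb (empirical x) i (β s) s) Q.law := by
  let _ := Q.events
  have hsum : Measurable fun s : JointStrategy T H =>
      (Fintype.card (Fin n → Fin m) : ℝ)⁻¹ * ∑ k : Fin n → Fin m,
        alloc i (Function.update (fun j => s j (x (k j) j)) i (β s)) := by
    refine measurable_const.mul (Finset.measurable_fun_sum _ fun k _ => ?_)
    refine (measurable_alloc i).comp (measurable_pi_lambda _ fun j => ?_)
    by_cases hj : j = i
    · subst hj
      simpa using hβ
    · simpa [hj] using Q.measurable_bid j (x (k j) j)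
  refine hsum.aestronglyMeasurable.congr ?_
  have hQ' : ∀ᵐ s ∂Q.law, ∀ i, Monotone (s i) := hQ
  filter_upwards [hQ'] with s hs
  exact (integral_pi_empirical hm x (measurable_alloc_update hs i (β s))).symm

/-- Joint measurability of `(s, t) ↦ s j t` is not available for a general `Q.events`, so Fubini
does not apply. Instead the function is an almost everywhere limit of its empirical counterparts. -/
theorem aestronglyMeasurable_winProb (Q : StrategyDist T H) (hQ : Q.IsMonotone) (i : Fin n)
    (β : JointStrategy T H → Bid H) (hβ : Measurable[Q.events] β) :
    AEStronglyMeasurable[Q.events] (fun s => winProb D i (β s) s) Q.law := by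
  let _ := Q.events
  choose m hm x hx using fun k : ℕ => exists_empirical_approx D H (Nat.one_div_pos_of_nat (n := k))
  have hQ' : ∀ᵐ s ∂Q.law, ∀ i, Monotone (s i) := hQ
  refine aestronglyMeasurable_of_tendsto_ae Filter.atTop
    (f := fun k s => winProb (empirical (x k)) i (β s) s)
    (fun k => aestronglyMeasurable_winProb_empirical (hm k) (x k) Q hQ i β hβ) ?_
  filter_upwards [hQ'] with s hs
  rw [tendsto_iff_dist_tendsto_zero]
  exact squeeze_zero (fun _ => dist_nonneg) (fun k => hx k s hs i (β s))
    tendsto_one_div_add_atTop_nhds_zero_nat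

theorem integrable_interimUtility {f g : Fin n → Bid H → Bid H} (hf : ∀ i, Measurable (f i))
    (hg : ∀ i, Measurable (g i)) (Q : StrategyDist T H) (hQ : Q.IsMonotone) (i : Fin n)
    (v : T i) (β : JointStrategy T H → Bid H) (hβ : Measurable[Q.events] β) :
    Integrable (fun s => interimUtility f g D i v (β s) s) Q.law := by
  let _ := Q.events
  have := Q.isProbability
  have hQ' : ∀ᵐ s ∂Q.law, ∀ i, Monotone (s i) := hQ
  have hfβ : Measurable fun s => ((f i (β s) : Bid H) : ℝ) :=
    measurable_subtype_coe.comp ((hf i).comp hβ)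
  have hgβ : Measurable fun s => ((g i (β s) : Bid H) : ℝ) :=
    measurable_subtype_coe.comp ((hg i).comp hβ)
  have hbound : ∀ b : Bid H, |(b : ℝ)| ≤ H := fun b => by
    rw [abs_of_nonneg b.2.1]
    exact b.2.2
  refine Integrable.congr (f := fun s =>
    ((v : ℝ) - f i (β s)) * winProb D i (β s) s - g i (β s)) ?_ ?_
  · refine Integrable.sub ?_ (Integrable.of_bound hgβ.aestronglyMeasurable H
      (ae_of_all _ fun s => hbound _))
    refine Integrable.of_bound ((measurable_const.sub hfβ).aestronglyMeasurable.mul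
      (aestronglyMeasurable_winProb D Q hQ i β hβ)) (|(v : ℝ)| + H) ?_
    filter_upwards [hQ'] with s hs
    obtain ⟨h0, h1⟩ := winProb_mem_Icc D hs i (β s)
    rw [Real.norm_eq_abs, abs_mul, abs_of_nonneg h0]
    have h2 : |(v : ℝ) - f i (β s)| ≤ |(v : ℝ)| + H :=
      (abs_sub _ _).trans (by linarith [hbound (f i (β s))])
    nlinarith [abs_nonneg ((v : ℝ) - f i (β s))]
  · filter_upwards [hQ'] with s hs
    exact (interimUtility_eq D f g hs i v (β s)).symm

end WinProb

/-! ### From close gains to inclusions of equilibrium sets. -/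

section Transfer

variable {n : ℕ} {T : Fin n → Set ℝ} {H : ℝ}

/-- If no gain from a deviation changes by more than `2 * ε` between `D` and `D'`, then
equilibria for `D` are approximate equilibria for `D'`. -/
theorem BCE_subset_of_gain_close {f g : Fin n → Bid H → Bid H} (hf : ∀ i, Measurable (f i))
    (hg : ∀ i, Measurable (g i)) (D D' : ∀ i, Measure (T i)) [∀ i, IsProbabilityMeasure (D' i)]
    {ε ε' : ℝ}
    (hclose : ∀ (s : JointStrategy T H), (∀ i, Monotone (s i)) → ∀ (i : Fin n) (v : T i)
      (b b' : Bid H), |(interimUtility f g D' i v b' s - interimUtility f g D' i v b s) -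
        (interimUtility f g D i v b' s - interimUtility f g D i v b s)| ≤ 2 * ε) :
    BCE f g D ε' ⊆ BCE f g D' (ε' + 2 * ε) := by
  rintro Q ⟨hQ, hbce⟩
  let _ := Q.events
  have := Q.isProbability
  have hrec : ∀ (i : Fin n) (v : T i),
      Integrable (fun s => interimUtility f g D' i v (s i v) s) Q.law := fun i v =>
    integrable_interimUtility D' hf hg Q hQ i v (fun s => s i v) (Q.measurable_bid i v)
  have hdev : ∀ (i : Fin n) (v : T i) (φ : (T i → Bid H) → T i → Bid H), Q.IsDeviation i φ →
      Integrable (fun s => interimUtility f g D' i v (φ (s i) v) s) Q.law := fun i v φ hφ =>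
    integrable_interimUtility D' hf hg Q hQ i v (fun s => φ (s i) v) (hφ v)
  refine ⟨hQ, hrec, hdev, fun i v φ hφ => ?_⟩
  have hQ' : ∀ᵐ s ∂Q.law, ∀ i, Monotone (s i) := hQ
  have hinc := hbce.incentive i v φ hφ
  have h1 := hbce.integrable_recommended i v
  have h2 := hbce.integrable_deviation i v φ hφ
  have h3 : Integrable (fun s => interimUtility f g D i v (φ (s i) v) s -
      interimUtility f g D i v (s i v) s) Q.law := h2.sub h1
  have hle : ∫ s, (interimUtility f g D' i v (φ (s i) v) s -
      interimUtility f g D' i v (s i v) s) ∂Q.law ≤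
      ∫ s, ((interimUtility f g D i v (φ (s i) v) s - interimUtility f g D i v (s i v) s) +
        2 * ε) ∂Q.law := by
    refine integral_mono_ae ((hdev i v φ hφ).sub (hrec i v))
      (h3.add (integrable_const _)) ?_
    filter_upwards [hQ'] with s hs
    have := (abs_le.1 (hclose s hs i v (s i v) (φ (s i) v))).2
    linarith
  rw [integral_sub (hdev i v φ hφ) (hrec i v), integral_add h3 (integrable_const _),
    integral_sub h2 h1, integral_const, probReal_univ, one_smul] at hle
  linarith

end Transfer

/-! ### Comparison of gains under two distributions. -/

section Gains

variable {n : ℕ} {T : Fin n → Set ℝ} {H : ℝ} {f g : Fin n → Bid H → Bid H}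
  (D D' : ∀ i, Measure (T i)) [∀ i, IsProbabilityMeasure (D i)]
  [∀ i, IsProbabilityMeasure (D' i)] {s : JointStrategy T H}

/-- The unconditional payment `g` does not depend on the distribution and cancels. -/
theorem gain_sub_gain_eq (hs : ∀ i, Monotone (s i)) (i : Fin n) (v : T i) (b b' : Bid H) :
    (interimUtility f g D' i v b' s - interimUtility f g D' i v b s) -
        (interimUtility f g D i v b' s - interimUtility f g D i v b s) =
      ((v : ℝ) - f i b') * (winProb D' i b' s - winProb D i b' s) -
        ((v : ℝ) - f i b) * (winProb D' i b s - winProb D i b s) := by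
  simp only [interimUtility_eq _ f g hs]
  ring

/-- Gains are close when winning probabilities are. -/
theorem abs_gain_sub_gain_le_of_winProb_close (hT : ∀ i, T i ⊆ Icc (0 : ℝ) H) {η : ℝ}
    (hs : ∀ i, Monotone (s i))
    (hclose : ∀ (i : Fin n) (b : Bid H), |winProb D' i b s - winProb D i b s| ≤ η)
    (i : Fin n) (v : T i) (b b' : Bid H) :
    |(interimUtility f g D' i v b' s - interimUtility f g D' i v b s) -
        (interimUtility f g D i v b' s - interimUtility f g D i v b s)| ≤ 2 * (H * η) := by
  have hcoef : ∀ c : Bid H, |(v : ℝ) - f i c| ≤ H := fun c => by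
    rw [abs_le]
    constructor <;> linarith [(f i c).2.1, (f i c).2.2, (hT i v.2).1, (hT i v.2).2]
  have hprod : ∀ c : Bid H,
      |((v : ℝ) - f i c) * (winProb D' i c s - winProb D i c s)| ≤ H * η := fun c => by
    rw [abs_mul]
    exact mul_le_mul (hcoef c) (hclose i c) (abs_nonneg _) ((abs_nonneg _).trans (hcoef c))
  rw [gain_sub_gain_eq D D' hs]
  refine (abs_sub _ _).trans ?_
  linarith [hprod b, hprod b']

/-- Gains never differ by more than `H`, because winning probabilities increase with the bid. -/
theorem abs_gain_sub_gain_le (hT : ∀ i, T i ⊆ Icc (0 : ℝ) H) (hs : ∀ i, Monotone (s i))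
    (i : Fin n) (v : T i) (b b' : Bid H) :
    |(interimUtility f g D' i v b' s - interimUtility f g D' i v b s) -
        (interimUtility f g D i v b' s - interimUtility f g D i v b s)| ≤ H := by
  wlog hb : b ≤ b' generalizing b b'
  · have := this b' b (le_of_not_ge hb)
    rw [abs_le] at this ⊢
    constructor <;> linarith [this.1, this.2]
  rw [gain_sub_gain_eq D D' hs]
  obtain ⟨hx0, hx1⟩ := winProb_mem_Icc D hs i b
  obtain ⟨hx0', hx1'⟩ := winProb_mem_Icc D hs i b'
  obtain ⟨hy0, hy1⟩ := winProb_mem_Icc D' hs i b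
  obtain ⟨hy0', hy1'⟩ := winProb_mem_Icc D' hs i b'
  have hx := winProb_mono D hs i hb
  have hy := winProb_mono D' hs i hb
  obtain ⟨hv0, hv1⟩ := hT i v.2
  obtain ⟨hp0, hp1⟩ := (f i b).2
  obtain ⟨hq0, hq1⟩ := (f i b').2
  generalize winProb D i b s = x at *
  generalize winProb D i b' s = x' at *
  generalize winProb D' i b s = y at *
  generalize winProb D' i b' s = y' at *
  generalize ((f i b : Bid H) : ℝ) = p at *
  generalize ((f i b' : Bid H) : ℝ) = q at *
  generalize (v : ℝ) = w at *
  have key : ∀ {x x' y y' : ℝ}, 0 ≤ x → x' ≤ 1 → 0 ≤ y → y' ≤ 1 → x ≤ x' → y ≤ y' →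
      (w - q) * (y' - x') - (w - p) * (y - x) ≤ H := by
    intro x x' y y' hx0 hx1 hy0 hy1 hx hy
    -- The factors of `w`, `q`, `p` sum to zero and the coefficients lie in `[0, H]`. Only positive
    -- parts matter, and monotonicity in the bid keeps their total at most `1`; a termwise bound
    -- would give `2 * H`.
    have e : (w - q) * (y' - x') - (w - p) * (y - x) =
        w * ((y' - x') - (y - x)) + q * (x' - y') + p * (y - x) := by ring
    have hmul : ∀ {k : ℝ} (z : ℝ), 0 ≤ k → k ≤ H → k * z ≤ H * max 0 z := fun z hk0 hk1 =>
      (mul_le_mul_of_nonneg_left (le_max_right 0 z) hk0).trans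
        (mul_le_mul_of_nonneg_right hk1 (le_max_left 0 z))
    have hmax : max 0 ((y' - x') - (y - x)) + max 0 (x' - y') + max 0 (y - x) ≤ 1 := by
      rcases max_cases 0 ((y' - x') - (y - x)) with ⟨h1, _⟩ | ⟨h1, _⟩ <;>
      rcases max_cases 0 (x' - y') with ⟨h2, _⟩ | ⟨h2, _⟩ <;>
      rcases max_cases 0 (y - x) with ⟨h3, _⟩ | ⟨h3, _⟩ <;>
      rw [h1, h2, h3] <;> linarith
    have := mul_le_mul_of_nonneg_left hmax (hv0.trans hv1)
    rw [e]
    linarith [hmul ((y' - x') - (y - x)) hv0 hv1, hmul (x' - y') hq0 hq1, hmul (y - x) hp0 hp1]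
  rw [abs_le]
  constructor
  · have := key hy0 hy1' hx0 hx1' hy hx
    linarith
  · exact key hx0 hx1' hy0 hy1' hx hy

end Gains

/-! ### Constants and conclusion. -/

/-- Here `r` stands for `H / ε`. The assumptions `2 ≤ n` and `2 ≤ r` keep both logarithms at least
`log 2`, so that lower-order terms are absorbed into `n * log n * log r`. -/
theorem union_bound_le {n m : ℕ} (hn : 2 ≤ n) {r δ : ℝ} (hr : 2 ≤ r) (hδ : 0 < δ) (hδ1 : δ < 1)
    (hm : 40 * (r ^ 2 * (n * Real.log n * Real.log r + Real.log (n / δ))) ≤ m) {K : ℕ}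
    (hK : K ≤ 4 * n * r + 1) :
    (n * (2 * (((K : ℝ) + 1) ^ n * (K + 1) ^ n))) *
      (2 * Real.exp (-(2 * m * (1 / (2 * r)) ^ 2))) ≤ δ := by
  have hn' : (2 : ℝ) ≤ n := by exact_mod_cast hn
  have hn0 : (0 : ℝ) < n := by linarith
  have hr0 : 0 < r := by linarith
  have hl : (1 : ℝ) / 2 ≤ Real.log 2 := by linarith [Real.log_two_gt_d9]
  set a := Real.log n
  set b := Real.log r
  have hla : Real.log 2 ≤ a := Real.log_le_log two_pos hn'
  have hlb : Real.log 2 ≤ b := Real.log_le_log two_pos hr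
  have hlog5 : Real.log 5 ≤ 3 * Real.log 2 := by
    have := Real.log_le_log (by norm_num) (show (5 : ℝ) ≤ 2 ^ 3 by norm_num)
    rwa [Real.log_pow] at this
  -- Since `n * r ≥ 4`, the bound `4 * n * r + 2` is at most `5 * n * r`.
  have hK1 : (K : ℝ) + 1 ≤ Real.exp (Real.log 5 + a + b) := by
    rw [Real.exp_add, Real.exp_add, Real.exp_log (by norm_num), Real.exp_log hn0,
      Real.exp_log hr0]
    nlinarith
  -- As `a, b ≥ log 2 ≥ 1 / 2`, each of `a` and `b` is at most `2 * a * b`, and `log 5 ≤ 3 * log 2 ≤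
  -- 6 * a * b`.
  have hL : Real.log 5 + a + b ≤ 10 * (a * b) := by
    nlinarith [mul_le_mul hla hlb (by linarith) (by linarith)]
  have hpow : ((K : ℝ) + 1) ^ n ≤ Real.exp (n * (10 * (a * b))) := by
    rw [Real.exp_nat_mul]
    exact pow_le_pow_left₀ (by positivity) (hK1.trans (Real.exp_le_exp.2 hL)) n
  have hnδ : (n : ℝ) / δ = Real.exp (Real.log (n / δ)) := (Real.exp_log (by positivity)).symm
  set c := Real.log (n / δ)
  have hlc : Real.log 2 ≤ c := by
    refine Real.log_le_log two_pos ?_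
    rw [le_div_iff₀ hδ]
    nlinarith
  have h4 : (4 : ℝ) = Real.exp (2 * Real.log 2) := by
    rw [two_mul, Real.exp_add, Real.exp_log two_pos]
    norm_num
  have hn_eq : (n : ℝ) = δ * Real.exp c := by
    rw [← hnδ]
    field_simp
  have hexponent : 2 * Real.log 2 + c + (n * (10 * (a * b)) + n * (10 * (a * b))) -
      2 * m * (1 / (2 * r)) ^ 2 ≤ 0 := by
    have h1 : 2 * (m : ℝ) * (1 / (2 * r)) ^ 2 = m / (2 * r ^ 2) := by
      field_simp
    have h2 : 20 * (n * a * b + c) ≤ m / (2 * r ^ 2) := by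
      rw [le_div_iff₀ (by positivity)]
      linarith
    rw [h1]
    linarith
  calc (n * (2 * (((K : ℝ) + 1) ^ n * (K + 1) ^ n))) *
        (2 * Real.exp (-(2 * m * (1 / (2 * r)) ^ 2)))
      = 4 * n * (((K : ℝ) + 1) ^ n * (K + 1) ^ n) *
        Real.exp (-(2 * m * (1 / (2 * r)) ^ 2)) := by ring
    _ ≤ 4 * n * (Real.exp (n * (10 * (a * b))) * Real.exp (n * (10 * (a * b)))) *
        Real.exp (-(2 * m * (1 / (2 * r)) ^ 2)) := by gcongr
    _ = δ * Real.exp (2 * Real.log 2 + c + (n * (10 * (a * b)) + n * (10 * (a * b))) -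
        2 * m * (1 / (2 * r)) ^ 2) := by
        rw [sub_eq_add_neg, Real.exp_add, Real.exp_add, Real.exp_add, Real.exp_add, ← h4]
        nth_rewrite 1 [hn_eq]
        ring
    _ ≤ δ * 1 := by
        gcongr
        exact Real.exp_le_one_iff.2 hexponent
    _ = δ := mul_one δ

end Auction

theorem mainTheorem2 :
    ∃ C : ℝ, 0 < C ∧
      ∀ (n : ℕ) (_ : 0 < n) (H : ℝ) (_ : 0 < H)
        (f g : Fin n → Auction.Bid H → Auction.Bid H)
        (_ : ∀ i, Measurable (f i)) (_ : ∀ i, Measurable (g i))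
        (T : Fin n → Set ℝ) (_ : ∀ i, T i ⊆ Set.Icc (0 : ℝ) H)
        (D : ∀ i, Measure (T i)) (_ : ∀ i, IsProbabilityMeasure (D i))
        (ε ε' δ : ℝ) (_ : 0 < ε) (_ : 0 < ε') (_ : 0 < δ) (_ : δ < 1)
        (m : ℕ) (_ : 0 < m)
        (_ : C * (H ^ 2 / ε ^ 2 *
              ((n : ℝ) * Real.log n * Real.log (H / ε) + Real.log ((n : ℝ) / δ))) ≤ (m : ℝ)),
        ∃ E : Set (Fin m → ∀ i, T i),
          MeasurableSet E ∧
          ENNReal.ofReal (1 - δ) ≤ Measure.pi (fun _ : Fin m => Measure.pi D) E ∧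
          ∀ x ∈ E,
            Auction.BCE f g (Auction.empirical x) ε' ⊆ Auction.BCE f g D (ε' + 2 * ε) ∧
            Auction.BCE f g D ε' ⊆ Auction.BCE f g (Auction.empirical x) (ε' + 2 * ε) := by
  refine ⟨40, by norm_num, ?_⟩
  intro n hn H hH f g hf hg T hT D hD ε ε' δ hε hε' hδ hδ1 m hm hsamples
  suffices h : ∃ E : Set (Fin m → ∀ i, T i), MeasurableSet E ∧
      (Measure.pi fun _ : Fin m => Measure.pi D).real Eᶜ ≤ δ ∧
      ∀ x ∈ E, ∀ (s : Auction.JointStrategy T H), (∀ i, Monotone (s i)) →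
        ∀ (i : Fin n) (v : T i) (b b' : Auction.Bid H),
        |(Auction.interimUtility f g (Auction.empirical x) i v b' s -
            Auction.interimUtility f g (Auction.empirical x) i v b s) -
          (Auction.interimUtility f g D i v b' s - Auction.interimUtility f g D i v b s)| ≤
          2 * ε by
    obtain ⟨E, hE, hμ, hclose⟩ := h
    refine ⟨E, hE, ?_, fun x hx => ?_⟩
    · rw [probReal_compl_eq_one_sub hE] at hμ
      rw [← ofReal_measureReal]
      exact ENNReal.ofReal_le_ofReal (by linarith)
    · have := Auction.isProbabilityMeasure_empirical hm x
      refine ⟨Auction.BCE_subset_of_gain_close hf hg _ _ fun s hs i v b b' => ?_,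
        Auction.BCE_subset_of_gain_close hf hg _ _ (hclose x hx)⟩
      rw [abs_sub_comm]
      exact hclose x hx s hs i v b b'
  -- For `H ≤ 2 * ε` the factor `log (H / ε)` may be small or negative, but every sample works
  -- because gains never differ by more than `H`.
  rcases le_or_gt H (2 * ε) with hlarge | hsmall
  · refine ⟨univ, MeasurableSet.univ, by simpa using hδ.le, fun x _ s hs i v b b' => ?_⟩
    have := Auction.isProbabilityMeasure_empirical hm x
    exact (Auction.abs_gain_sub_gain_le D _ hT hs i v b b').trans hlarge
  -- For `n = 1` the factor `log n` vanishes, but winning is certain and gains do not depend on the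
  -- distribution.
  rcases Nat.lt_or_ge n 2 with hn1 | hn2
  · obtain rfl : n = 1 := by omega
    refine ⟨univ, MeasurableSet.univ, by simpa using hδ.le, fun x _ s hs i v b b' => ?_⟩
    have := Auction.isProbabilityMeasure_empirical hm x
    rw [Auction.gain_sub_gain_eq D _ hs]
    simp only [Auction.winProb_eq_one_of_subsingleton]
    simp [hε.le]
  · have hn0 : (0 : ℝ) < n := by exact_mod_cast hn
    have hr : 2 ≤ H / ε := by
      rw [le_div_iff₀ hε]
      exact hsmall.le
    have hr0 : 0 < H / ε := by positivity
    -- The error `ε / H` is split equally between the deviation `τ` and the bracket width `2 * n /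
    -- K`.
    set K := ⌈4 * n * (H / ε)⌉₊
    have hKle : 4 * n * (H / ε) ≤ K := Nat.le_ceil _
    have hK0 : (0 : ℝ) < K := lt_of_lt_of_le (by positivity) hKle
    obtain ⟨E, hE, hμ, hclose⟩ := Auction.exists_event_uniform_winProb D H hm (K := K)
      (by exact_mod_cast hK0) (τ := 1 / (2 * (H / ε))) (by positivity)
    refine ⟨E, hE, hμ.trans (Auction.union_bound_le hn2 hr hδ hδ1 ?_
      (Nat.ceil_lt_add_one (by positivity)).le), fun x hx s hs i v b b' => ?_⟩
    · rwa [div_pow]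
    · have := Auction.isProbabilityMeasure_empirical hm x
      have hη : 1 / (2 * (H / ε)) + 2 * n / K ≤ ε / H := by
        have h1 : 2 * n / K ≤ ε / H / 2 := by
          rw [div_le_iff₀ hK0]
          calc 2 * (n : ℝ) = ε / H / 2 * (4 * n * (H / ε)) := by
                field_simp
                ring
            _ ≤ ε / H / 2 * K := by gcongr
        have h2 : 1 / (2 * (H / ε)) = ε / H / 2 := by
          field_simp
        linarith
      have := Auction.abs_gain_sub_gain_le_of_winProb_close (f := f) (g := g) D
        (Auction.empirical x) hT hs (fun i b => (hclose x hx s hs i b).trans hη) i v b b'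
      rwa [mul_div_cancel₀ _ hH.ne'] at this
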